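/- Let $K$ be an infinite field, $P=K[x_1,\dots,x_n]$ with the standard grading, and let $i\in\{1,\dots,n\}$. For a term ordering $\sigma$ and an ideal $I$, let $\mathrm{in}_\sigma(I)$ be the ideal generated by the leading power products of the nonzero elements of $I$. A property of points of an affine space over $K$ holds generically if it holds off the zero set of some nonzero polynomial. A matrix $g\in \mathrm{GL}(n,K)$ acts on $P$ by the $K$-algebra automorphism $x_j\mapsto\sum_k g_{kj}x_k$. For a homogeneous ideal $I$, $\mathrm{gin}_\sigma(I)$ denotes the ideal that equals $\mathrm{in}_\sigma(g(I))$ for generic $g\in\mathrm{GL}(n,K)$. The same definitions are used for the polynomial ring $\hat P=K[x_1,\dots,x_{i-1},x_{i+1},\dots,x_n]$. For a linear form $h=\sum_j h_jx_j$ with $h_i\neq 0$, the $h$-hyperplane section of an ideal $I$ of $P$ is the ideal $I_h=\phi(I)$ of $\hat P$, where $\phi:P\to\hat P$ is the $K$-algebra homomorphism with $\phi(x_j)=x_j$ for $j\neq i$ and $\phi(x_i)=-\frac1{h_i}\sum_{j\neq i}h_jx_j$. In particular $I_{x_i}$ is the image of $I$ under $x_i\mapsto 0$. A term ordering $\sigma$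 is of $x_i$-DegRev type if it is degree-compatible and, whenever $\deg t=\deg t'$ and the exponent of $x_i$ in $t$ is smaller than that in $t'$, one has $t>_\sigma t'$. Let $\sigma_{\hat x_i}$ be the restriction of $\sigma$ to the power products in the indeterminates other than $x_i$. **Theorem (Gin and Hyperplane Sections).** Let $I$ be a homogeneous ideal of $P$ and let $\sigma$ be a term ordering of $x_i$-DegRev type. Then $\mathrm{gin}_\sigma(I)$ exists, and for a generic linear form $h=\sum_j h_jx_j$ (that is, generic $(h_1,\dots,h_n)\in K^n$) one has $h_i\neq 0$, $\mathrm{gin}_{\sigma_{\hat x_i}}(I_h)$ exists, and $$\mathrm{gin}_{\sigma_{\hat x_i}}(I_h)=\big(\mathrm{gin}_\sigma(I)\big)_{x_i}$$ as ideals of $\hat P$. -/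

import Mathlib

open MvPolynomial
open scoped MonomialOrder

attribute [local instance] MvPolynomial.gradedAlgebra

/-- The initial ideal `in_σ(I)`: the ideal generated by the leading power products (with respect
to the term ordering `σ`) of the nonzero elements of `I`. -/
noncomputable def initialIdeal {ν K : Type*} [Field K] (σ : MonomialOrder ν)
    (I : Ideal (MvPolynomial ν K)) : Ideal (MvPolynomial ν K) :=
  Ideal.span {t | ∃ f ∈ I, f ≠ 0 ∧ t = monomial (σ.degree f) (1 : K)}

/-- The action of a matrix on polynomials by linear change of coordinates: the `K`-algebra
endomorphism with `x_j ↦ ∑ k, g k j • x_k`. -/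
noncomputable def linearChange {ν K : Type*} [Fintype ν] [Field K] (g : Matrix ν ν K) :
    MvPolynomial ν K →ₐ[K] MvPolynomial ν K :=
  aeval fun j => ∑ k, C (g k j) * X k

/-- A property of points of the affine space `K^ι` holds generically if it holds on a nonempty
Zariski-open subset, i.e. off the zero set of some nonzero polynomial. -/
def HoldsGenerically {ι K : Type*} [Field K] (p : (ι → K) → Prop) : Prop :=
  ∃ F : MvPolynomial ι K, F ≠ 0 ∧ ∀ a : ι → K, eval a F ≠ 0 → p a

/-- `J` is the initial ideal `in_σ(g(I))` for a generic invertible matrix `g`. -/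
def IsGin {ν K : Type*} [Fintype ν] [DecidableEq ν] [Field K] (σ : MonomialOrder ν)
    (I J : Ideal (MvPolynomial ν K)) : Prop :=
  HoldsGenerically fun a : ν × ν → K =>
    ∀ g : Matrix.GeneralLinearGroup ν K, (∀ k l, (g : Matrix ν ν K) k l = a (k, l)) →
      initialIdeal σ (I.map (linearChange (g : Matrix ν ν K))) = J

open Classical in
/-- The generic initial ideal `gin_σ(I)`: the common value of `in_σ(g(I))` for generic `g`
(with the value `⊥` in case there were no such common value). -/
noncomputable def gin {ν K : Type*} [Fintype ν] [DecidableEq ν] [Field K] (σ : MonomialOrder ν)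
    (I : Ideal (MvPolynomial ν K)) : Ideal (MvPolynomial ν K) :=
  if hI : ∃ J, IsGin σ I J then hI.choose else ⊥

/-- The homomorphism `φ : K[x_1,…,x_n] → K[x_1,…,x̂_i,…,x_n]` attached to the linear form
`∑ j, h j • x_j` (with `h i ≠ 0`): `x_j ↦ x_j` for `j ≠ i` and
`x_i ↦ -(1 / h_i) ∑_{j ≠ i} h_j x_j`. -/
noncomputable def hyperplaneHom {ν K : Type*} [Fintype ν] [DecidableEq ν] [Field K]
    (i : ν) (h : ν → K) : MvPolynomial ν K →ₐ[K] MvPolynomial {j : ν // j ≠ i} K :=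
  aeval fun j => if hj : j = i then -(C (h i)⁻¹ * ∑ k : {k : ν // k ≠ i}, C (h k) * X k)
    else X ⟨j, hj⟩

/-- The hyperplane section ideal `I_h = φ(I)` with respect to the linear form `∑ j, h j • x_j`
(with `h i ≠ 0`), as an ideal of `K[x_1,…,x̂_i,…,x_n]`. -/
noncomputable def hyperplaneSection {ν K : Type*} [Fintype ν] [DecidableEq ν] [Field K]
    (i : ν) (h : ν → K) (I : Ideal (MvPolynomial ν K)) :
    Ideal (MvPolynomial {j : ν // j ≠ i} K) :=
  I.map (hyperplaneHom i h)

/-- A term ordering of `x_i`-DegRev type: it is degree-compatible, and among power products of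
equal degree, those with smaller exponent at `x_i` are larger. -/
structure IsDegRevType {ν : Type*} (i : ν) (σ : MonomialOrder ν) : Prop where
  degree_compatible : ∀ s t : ν →₀ ℕ, s.degree < t.degree → s ≺[σ] t
  rev : ∀ s t : ν →₀ ℕ, s.degree = t.degree → s i < t i → t ≺[σ] s

/-- Power products in the variables other than `x_i`, seen as power products in all variables. -/
noncomputable def includeExponents {ν : Type*} (i : ν) : ({j : ν // j ≠ i} →₀ ℕ) →+ (ν →₀ ℕ) :=
  Finsupp.mapDomain.addMonoidHom Subtype.val

theorem includeExponents_injective {ν : Type*} (i : ν) :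
    Function.Injective (includeExponents i) :=
  Finsupp.mapDomain_injective Subtype.val_injective

/-- The map sending a power product in the variables other than `x_i` to its value in the ordered
monoid underlying the term ordering `σ`. -/
noncomputable def restrictHom {ν : Type*} (i : ν) (σ : MonomialOrder ν) :
    ({j : ν // j ≠ i} →₀ ℕ) →+ σ.syn :=
  (σ.toSyn : (ν →₀ ℕ) →+ σ.syn).comp (includeExponents i)

/-- The restriction of a term ordering to the power products in the variables other than
`x_i`. -/
noncomputable def restrictOrder {ν : Type*} (i : ν) (σ : MonomialOrder ν) :
    MonomialOrder {j : ν // j ≠ i} :=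
  let e : ({j : ν // j ≠ i} →₀ ℕ) ≃+ AddMonoidHom.mrange (restrictHom i σ) :=
    AddEquiv.ofBijective (restrictHom i σ).mrangeRestrict
      ⟨fun _ _ hab => includeExponents_injective i (σ.toSyn.injective (congrArg Subtype.val hab)),
        AddMonoidHom.mrangeRestrict_surjective _⟩
  { syn := AddMonoidHom.mrange (restrictHom i σ)
    toSyn := e
    toSyn_monotone := fun _ _ hab => σ.toSyn_monotone (Finsupp.mapDomain_mono hab) }

/-- The restricted ordering compares power products as the original ordering does. -/
theorem restrictOrder_le_iff {ν : Type*} (i : ν) (σ : MonomialOrder ν)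
    (s t : {j : ν // j ≠ i} →₀ ℕ) :
    s ≼[restrictOrder i σ] t ↔ includeExponents i s ≼[σ] includeExponents i t :=
  Iff.rfl

/-! ### Leading exponents and linear independence. -/

section LeadingExponents

variable {ν R : Type*} [CommRing R] (σ : MonomialOrder ν)

/-! Existence: apply to `I` the change of coordinates by a matrix of indeterminates. The leading
exponents of the result span a monomial ideal, `genericInitialIdeal`. It has finitely many
generators, so off the zeros of finitely many leading coefficients they survive specialization, and
`in(gI)` contains it. Equality follows by counting in each degree: independent homogeneous elements
of `gI`, pulled back to `I` and changed generically, stay independent, so they yield at least as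
many generic leading exponents (`initialIdeal_le_genericInitialIdeal`).

Sections: for a DegRev type ordering, `in` commutes with `x_i ↦ 0` on homogeneous ideals
(`initialIdeal_hyperplaneSection_single`). If `g` carries the form `h` to a multiple of `x_i`, then
`g` followed by `x_i ↦ 0` equals the `h`-section followed by the submatrix `g'` of `g` without row
and column `i` (`hyperplaneHom_single_comp_linearChange`). Hence `in(g'(I_h)) = in(gI)_{x_i}`. It
remains to see that for generic `h` and generic `g'` some such `g` is generic enough for `gin(I)`:
`holdsGenerically_exists_extendMatrix`. -/

theorem MonomialOrder.degree_eq_of_coeff_ne_zero {f : MvPolynomial ν R} {t : ν →₀ ℕ}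
    (ht : coeff t f ≠ 0) (h : ∀ u, coeff u f ≠ 0 → u ≼[σ] t) : σ.degree f = t := by
  apply σ.toSyn.injective
  apply le_antisymm
  · exact σ.degree_le_iff.2 fun u hu => h u (mem_support_iff.1 hu)
  · exact σ.le_degree (mem_support_iff.2 ht)

/-- A linearly independent family has at most as many members as there are leading exponents
in its span. -/
theorem card_le_card_of_degree_mem [Nontrivial R] {ι : Type*} [Fintype ι]
    {u : ι → MvPolynomial ν R} (hu : LinearIndependent R u) (A : Finset (ν →₀ ℕ))
    (hA : ∀ w ∈ Submodule.span R (Set.range u), w ≠ 0 → σ.degree w ∈ A) :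
    Fintype.card ι ≤ A.card := by
  -- Reading off the coefficients at `A` is injective on the span, since a nonzero element has a
  -- nonzero leading coefficient.
  let f : MvPolynomial ν R →ₗ[R] (A → R) := LinearMap.pi fun t => lcoeff R t.1
  have hf : LinearIndependent R (f ∘ u) := by
    apply hu.map
    rw [Submodule.disjoint_def]
    intro w hw hfw
    by_contra hw0
    have := congrFun (LinearMap.mem_ker.1 hfw) ⟨σ.degree w, hA w hw hw0⟩
    exact σ.coeff_degree_ne_zero_iff.2 hw0 this
  simpa using hf.fintype_card_le_finrank

/-- Nonzero polynomials with distinct leading exponents are linearly independent. -/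
theorem linearIndependent_of_degree_injective [IsDomain R] {ι : Type*}
    {u : ι → MvPolynomial ν R} (h0 : ∀ j, u j ≠ 0)
    (hinj : Function.Injective fun j => σ.degree (u j)) : LinearIndependent R u := by
  classical
  rw [linearIndependent_iff']
  intro s c hc j hj
  by_contra hcj
  -- Among the terms with nonzero coefficient, the one with the largest leading exponent cannot be
  -- cancelled.
  obtain ⟨m, hm, hmax⟩ := Finset.exists_max_image (s.filter fun k => c k ≠ 0)
    (fun k => σ.toSyn (σ.degree (u k))) ⟨j, by simp [hj, hcj]⟩
  rw [Finset.mem_filter] at hm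
  have h1 := congrArg (coeff (σ.degree (u m))) hc
  rw [coeff_sum, Finset.sum_eq_single m] at h1
  · simp only [coeff_smul, coeff_zero, smul_eq_mul, mul_eq_zero] at h1
    exact h1.elim hm.2 (σ.coeff_degree_ne_zero_iff.2 (h0 m))
  · intro k hk hkm
    by_cases hck : c k = 0
    · simp [hck]
    · rw [coeff_smul, σ.coeff_eq_zero_of_lt, smul_zero]
      exact lt_of_le_of_ne (hmax k (by simp [hk, hck])) fun h =>
        hkm (hinj (σ.toSyn.injective h))
  · exact fun h => (h hm.1).elim

end LeadingExponents

/-! ### Homogeneous ideals and their initial ideals. -/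

section Homogeneous

variable {ν K : Type*} [Field K] {I : Ideal (MvPolynomial ν K)}

theorem homogeneousComponent_mem_of_isHomogeneous
    (hI : I.IsHomogeneous (homogeneousSubmodule ν K)) {f : MvPolynomial ν K} (hf : f ∈ I) (d : ℕ) :
    homogeneousComponent d f ∈ I := by
  rw [← decomposition.decompose'_apply]
  exact hI d hf

theorem exists_isHomogeneous_degree_eq (σ : MonomialOrder ν)
    (hI : I.IsHomogeneous (homogeneousSubmodule ν K)) {f : MvPolynomial ν K} (hf : f ∈ I)
    (hf0 : f ≠ 0) : ∃ p ∈ I, p.IsHomogeneous (σ.degree f).degree ∧ p ≠ 0 ∧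
      σ.degree p = σ.degree f := by
  classical
  have hc := σ.coeff_degree_ne_zero_iff.2 hf0
  have hc' : coeff (σ.degree f) (homogeneousComponent (σ.degree f).degree f) ≠ 0 := by
    simpa [coeff_homogeneousComponent] using hc
  refine ⟨homogeneousComponent (σ.degree f).degree f,
    homogeneousComponent_mem_of_isHomogeneous hI hf _, homogeneousComponent_isHomogeneous _ _,
    fun h => hc' (by rw [h, coeff_zero]), σ.degree_eq_of_coeff_ne_zero hc' fun u hu => ?_⟩
  rw [coeff_homogeneousComponent] at hu
  exact σ.le_degree (mem_support_iff.2 fun h => hu (by simp [h]))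

/-- A monomial in a monomial ideal is divisible by a generator; multiplying the corresponding `f` by
the quotient realizes it as a leading exponent. -/
theorem monomial_mem_initialIdeal_iff (σ : MonomialOrder ν) {t : ν →₀ ℕ} :
    monomial t (1 : K) ∈ initialIdeal σ I ↔ ∃ f ∈ I, f ≠ 0 ∧ σ.degree f = t := by
  classical
  constructor
  · intro h
    have hS : {t | ∃ f ∈ I, f ≠ 0 ∧ t = monomial (σ.degree f) (1 : K)} =
        (fun s => monomial s (1 : K)) '' {s | ∃ f ∈ I, f ≠ 0 ∧ σ.degree f = s} := by
      ext p
      simp only [Set.mem_ofPred_eq, Set.mem_image]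
      constructor
      · rintro ⟨f, hf, h0, rfl⟩
        exact ⟨_, ⟨f, hf, h0, rfl⟩, rfl⟩
      · rintro ⟨_, ⟨f, hf, h0, rfl⟩, rfl⟩
        exact ⟨f, hf, h0, rfl⟩
    rw [initialIdeal, hS, mem_ideal_span_monomial_image] at h
    obtain ⟨_, ⟨f, hf, h0, rfl⟩, hle⟩ := h t (by simp [mem_support_iff])
    have hm : monomial (t - σ.degree f) (1 : K) ≠ 0 := by simp
    refine ⟨monomial (t - σ.degree f) 1 * f, I.mul_mem_left _ hf, mul_ne_zero hm h0, ?_⟩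
    rw [σ.degree_mul hm h0, σ.degree_monomial, if_neg one_ne_zero, tsub_add_cancel_of_le hle]
  · rintro ⟨f, hf, h0, rfl⟩
    exact Ideal.subset_span ⟨f, hf, h0, rfl⟩

end Homogeneous

/-! ### Linear and generic changes of coordinates. -/

section LinearChange

variable {ν K : Type*} [Fintype ν] [Field K]

theorem linearChange_comp (A B : Matrix ν ν K) :
    (linearChange A).comp (linearChange B) = linearChange (A * B) := by
  refine algHom_ext fun j => ?_
  simp only [linearChange, AlgHom.comp_apply, aeval_X, map_sum, map_mul, algHom_C,
    algebraMap_eq, Matrix.mul_apply, Finset.sum_mul, Finset.mul_sum]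
  rw [Finset.sum_comm]
  refine Finset.sum_congr rfl fun k _ => Finset.sum_congr rfl fun l _ => ?_
  ring

theorem linearChange_one [DecidableEq ν] : linearChange (1 : Matrix ν ν K) = AlgHom.id K _ := by
  refine algHom_ext fun j => ?_
  simp [linearChange, Matrix.one_apply]

theorem linearChange_apply_of_mul_eq_one [DecidableEq ν] {A B : Matrix ν ν K} (h : A * B = 1)
    (f : MvPolynomial ν K) : linearChange A (linearChange B f) = f := by
  rw [← AlgHom.comp_apply, linearChange_comp, h, linearChange_one, AlgHom.id_apply]

theorem linearChange_isHomogeneous (g : Matrix ν ν K) {f : MvPolynomial ν K} {d : ℕ}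
    (hf : f.IsHomogeneous d) : (linearChange g f).IsHomogeneous d := by
  rw [← one_mul d]
  exact hf.aeval _ fun j => IsHomogeneous.sum _ _ _ fun k _ => isHomogeneous_C_mul_X _ _

theorem map_linearChange_isHomogeneous (g : Matrix ν ν K) {I : Ideal (MvPolynomial ν K)}
    (hI : I.IsHomogeneous (homogeneousSubmodule ν K)) :
    (I.map (linearChange g)).IsHomogeneous (homogeneousSubmodule ν K) := by
  obtain ⟨S, rfl⟩ := (Ideal.IsHomogeneous.iff_exists _ _).1 hI
  rw [Ideal.map_span]
  apply Ideal.homogeneous_span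
  rintro _ ⟨_, ⟨⟨f, d, hf⟩, -, rfl⟩, rfl⟩
  exact ⟨d, linearChange_isHomogeneous g hf⟩

/-- Linear change of coordinates by the matrix of indeterminates. -/
noncomputable def genericChange (ν K : Type*) [Fintype ν] [Field K] :
    MvPolynomial ν K →ₐ[K] MvPolynomial ν (MvPolynomial (ν × ν) K) :=
  aeval fun j => ∑ k, C (X (k, j)) * X k

theorem map_eval_genericChange (a : ν × ν → K) (f : MvPolynomial ν K) :
    MvPolynomial.map (eval a) (genericChange ν K f) =
      linearChange (Matrix.of fun k l => a (k, l)) f := by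
  induction f using MvPolynomial.induction_on with
  | C c =>
    rw [algHom_C, algHom_C, MvPolynomial.algebraMap_apply, map_C, algebraMap_eq, algebraMap_eq,
      eval_C]
  | add p q hp hq => simp only [map_add, hp, hq]
  | mul_X p j hp => simp only [map_mul, hp]; simp [genericChange, linearChange]

theorem genericChange_isHomogeneous {f : MvPolynomial ν K} {d : ℕ}
    (hf : f.IsHomogeneous d) : (genericChange ν K f).IsHomogeneous d := by
  rw [← one_mul d]
  exact hf.aeval _ fun j => IsHomogeneous.sum _ _ _ fun k _ => isHomogeneous_C_mul_X _ _

/-- Specializing a relation at an invertible matrix and undoing the change gives a relation over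
`K`, so each coefficient vanishes wherever the determinant does not. Its product with the
determinant then vanishes everywhere, hence is zero as `K` is infinite. -/
theorem linearIndependent_genericChange [DecidableEq ν] [Infinite K] {ι : Type*}
    {u : ι → MvPolynomial ν K} (hu : LinearIndependent K u) :
    LinearIndependent (MvPolynomial (ν × ν) K) fun j => genericChange ν K (u j) := by
  rw [linearIndependent_iff'] at hu ⊢
  intro s c hc j hj
  suffices c j * (Matrix.mvPolynomialX ν ν K).det = 0 from
    (mul_eq_zero.1 this).resolve_right (Matrix.det_mvPolynomialX_ne_zero _ _)
  refine MvPolynomial.funext fun a => ?_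
  rw [map_mul, map_zero, Matrix.eval_det_mvPolynomialX]
  by_cases hdet : (Matrix.of fun i j : ν => a (i, j)).det = 0
  · rw [hdet, mul_zero]
  suffices eval a (c j) = 0 by rw [this, zero_mul]
  refine hu s (fun k => eval a (c k)) ?_ j hj
  have h1 := congrArg (MvPolynomial.map (eval a)) hc
  simp only [map_sum, smul_eq_C_mul, map_mul, map_C, map_eval_genericChange, map_zero] at h1
  have h2 := congrArg (linearChange (Matrix.of fun i j : ν => a (i, j))⁻¹) h1
  simp only [map_sum, map_mul, map_zero, algHom_C, algebraMap_eq] at h2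
  simpa only [smul_eq_C_mul, linearChange_apply_of_mul_eq_one
    (Matrix.nonsing_inv_mul _ (Ne.isUnit hdet))] using h2

end LinearChange

/-! ### Existence and uniqueness of the generic initial ideal. -/

section Gin

variable {ν K : Type*} [Fintype ν] [Field K]

/-- The ideal generated by the leading power products after the generic change of coordinates. -/
noncomputable def genericInitialIdeal (σ : MonomialOrder ν) (I : Ideal (MvPolynomial ν K)) :
    Ideal (MvPolynomial ν K) :=
  Ideal.span {t | ∃ G ∈ I.map (genericChange ν K), G ≠ 0 ∧ t = monomial (σ.degree G) (1 : K)}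

/-- Specialization creates no new exponents, so the leading exponent persists once its coefficient
does. -/
theorem monomial_degree_mem_initialIdeal (σ : MonomialOrder ν) {I : Ideal (MvPolynomial ν K)}
    {G : MvPolynomial ν (MvPolynomial (ν × ν) K)} (hG : G ∈ I.map (genericChange ν K))
    {a : ν × ν → K} (ha : eval a (σ.leadingCoeff G) ≠ 0) :
    monomial (σ.degree G) (1 : K) ∈
      initialIdeal σ (I.map (linearChange (Matrix.of fun k l => a (k, l)))) := by
  have hc : coeff (σ.degree G) (MvPolynomial.map (eval a) G) ≠ 0 := by
    rwa [coeff_map]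
  refine (monomial_mem_initialIdeal_iff σ).2
    ⟨MvPolynomial.map (eval a) G, ?_, fun h => hc (by rw [h, coeff_zero]),
      σ.degree_eq_of_coeff_ne_zero hc fun u hu => ?_⟩
  · have h := Ideal.mem_map_of_mem (MvPolynomial.map (σ := ν) (eval a)) hG
    refine (?_ : Ideal.map _ _ ≤ _) h
    rw [Ideal.map_le_iff_le_comap, Ideal.map_le_iff_le_comap]
    intro f hf
    rw [Ideal.mem_comap, Ideal.mem_comap, map_eval_genericChange]
    exact Ideal.mem_map_of_mem _ hf
  · rw [coeff_map] at hu
    exact σ.le_degree (mem_support_iff.2 fun h => hu (by rw [h, map_zero]))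

theorem holdsGenerically_genericInitialIdeal_le (σ : MonomialOrder ν)
    (I : Ideal (MvPolynomial ν K)) :
    HoldsGenerically fun a : ν × ν → K => genericInitialIdeal σ I ≤
      initialIdeal σ (I.map (linearChange (Matrix.of fun k l => a (k, l)))) := by
  obtain ⟨S, hS, hspan⟩ := (Submodule.fg_span_iff_fg_span_finset_subset _).1
    (IsNoetherian.noetherian (genericInitialIdeal σ I))
  have hS' : ∀ t ∈ S, ∃ G ∈ I.map (genericChange ν K), G ≠ 0 ∧
      t = monomial (σ.degree G) (1 : K) := fun t ht => hS ht
  choose! G hG hG0 hGt using hS'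
  refine ⟨∏ t ∈ S, σ.leadingCoeff (G t),
    Finset.prod_ne_zero_iff.2 fun t ht => σ.leadingCoeff_ne_zero_iff.2 (hG0 t ht), fun a ha => ?_⟩
  rw [map_prod, Finset.prod_ne_zero_iff] at ha
  rw [genericInitialIdeal, Ideal.span, hspan, Submodule.span_le]
  intro t ht
  rw [hGt t ht]
  exact monomial_degree_mem_initialIdeal σ (hG t ht) (ha t ht)

/-- If the leading exponents after generic change of coordinates remain leading exponents after
the invertible change of coordinates `g`, then there are no others. -/
theorem initialIdeal_le_genericInitialIdeal [DecidableEq ν] [Infinite K] (σ : MonomialOrder ν)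
    {I : Ideal (MvPolynomial ν K)} (hI : I.IsHomogeneous (homogeneousSubmodule ν K))
    (g : Matrix.GeneralLinearGroup ν K)
    (hg : genericInitialIdeal σ I ≤ initialIdeal σ (I.map (linearChange (g : Matrix ν ν K)))) :
    initialIdeal σ (I.map (linearChange (g : Matrix ν ν K))) ≤ genericInitialIdeal σ I := by
  classical
  have hgI := map_linearChange_isHomogeneous (g : Matrix ν ν K) hI
  rw [initialIdeal, Ideal.span_le]
  rintro _ ⟨f, hf, hf0, rfl⟩
  set d := (σ.degree f).degree with hd
  set I' := I.map (linearChange (g : Matrix ν ν K)) with hI'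
  have hfin : {t : ν →₀ ℕ | t.degree = d}.Finite := by
    refine (Finsupp.finite_of_degree_le d).subset fun t ht => ?_
    exact le_of_eq ht
  have hAfin : {t : ν →₀ ℕ | t.degree = d ∧ ∃ p ∈ I', p ≠ 0 ∧ σ.degree p = t}.Finite :=
    hfin.subset fun t ht => ht.1
  set A := hAfin.toFinset with hA
  have hex : ∀ t : A, ∃ p ∈ I', p.IsHomogeneous d ∧ p ≠ 0 ∧ σ.degree p = t := by
    rintro ⟨t, ht⟩
    obtain ⟨h1, p, hp, hp0, rfl⟩ := hAfin.mem_toFinset.1 ht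
    rw [← h1]
    exact exists_isHomogeneous_degree_eq σ hgI hp hp0
  choose p hpI hph hp0 hpd using hex
  have hpli : LinearIndependent K p := linearIndependent_of_degree_injective σ hp0 fun s t hst =>
    Subtype.ext (by rw [← hpd, ← hpd]; exact hst)
  have hginv : (g : Matrix ν ν K) * ((g⁻¹ : Matrix.GeneralLinearGroup ν K) : Matrix ν ν K) = 1 := by
    rw [← Units.val_mul, mul_inv_cancel, Units.val_one]
  have hinvg : ((g⁻¹ : Matrix.GeneralLinearGroup ν K) : Matrix ν ν K) * (g : Matrix ν ν K) = 1 := by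
    rw [← Units.val_mul, inv_mul_cancel, Units.val_one]
  set b : Matrix ν ν K := ((g⁻¹ : Matrix.GeneralLinearGroup ν K) : Matrix ν ν K)
  -- Undoing `g` brings the `p t` back into `I`, where the generic change can be applied.
  have hqI : ∀ t, linearChange b (p t) ∈ I := by
    intro t
    have h := Ideal.mem_map_of_mem (linearChange b) (hpI t)
    refine (?_ : Ideal.map _ _ ≤ _) h
    rw [hI', Ideal.map_le_iff_le_comap, Ideal.map_le_iff_le_comap]
    intro f hf
    rwa [Ideal.mem_comap, Ideal.mem_comap, linearChange_apply_of_mul_eq_one hinvg]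
  have hqli : LinearIndependent K fun t => linearChange b (p t) :=
    hpli.map' (linearChange b).toLinearMap (LinearMap.ker_eq_bot.2
      (Function.LeftInverse.injective (g := linearChange (g : Matrix ν ν K))
        (linearChange_apply_of_mul_eq_one hginv)))
  have huli := linearIndependent_genericChange hqli
  set u := fun t => genericChange ν K (linearChange b (p t)) with hu
  have hspan : ∀ w ∈ Submodule.span (MvPolynomial (ν × ν) K) (Set.range u),
      w ∈ I.map (genericChange ν K) ∧ w.IsHomogeneous d := by
    intro w hw
    induction hw using Submodule.span_induction with
    | mem w hw =>
      obtain ⟨t, rfl⟩ := hw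
      exact ⟨Ideal.mem_map_of_mem _ (hqI t),
        genericChange_isHomogeneous (linearChange_isHomogeneous b (hph t))⟩
    | zero => exact ⟨Ideal.zero_mem _, isHomogeneous_zero _ _ _⟩
    | add v w _ _ hv hw => exact ⟨Ideal.add_mem _ hv.1 hw.1, hv.2.add hw.2⟩
    | smul c w _ hw =>
      rw [smul_eq_C_mul]
      exact ⟨Ideal.mul_mem_left _ _ hw.1, hw.2.C_mul c⟩
  set B := A.filter fun t => ∃ w ∈ Submodule.span (MvPolynomial (ν × ν) K) (Set.range u),
    w ≠ 0 ∧ σ.degree w = t with hB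
  -- The independent family `u` is indexed by `A`; by `hg`, every leading exponent in its span lies
  -- in `A`, hence in `B`. So `B` exhausts `A`.
  have hcard : Fintype.card A ≤ B.card := by
    refine card_le_card_of_degree_mem σ huli B fun w hw hw0 => ?_
    obtain ⟨hwI, hwh⟩ := hspan w hw
    refine Finset.mem_filter.2 ⟨hAfin.mem_toFinset.2 ⟨?_, ?_⟩, w, hw, hw0, rfl⟩
    · have := hwh (σ.coeff_degree_ne_zero_iff.2 hw0)
      rwa [Finsupp.degree_eq_weight_one]
    · exact (monomial_mem_initialIdeal_iff σ).1 (hg (Ideal.subset_span ⟨w, hwI, hw0, rfl⟩))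
  rw [Fintype.card_coe] at hcard
  have hBA : B = A := Finset.eq_of_subset_of_card_le (Finset.filter_subset _ _) hcard
  have hfB : σ.degree f ∈ B := hBA ▸ hAfin.mem_toFinset.2 ⟨rfl, f, hf, hf0, rfl⟩
  obtain ⟨-, w, hw, hw0, hwd⟩ := Finset.mem_filter.1 hfB
  exact Ideal.subset_span ⟨w, (hspan w hw).1, hw0, by rw [hwd]⟩

theorem isGin_genericInitialIdeal [DecidableEq ν] [Infinite K] (σ : MonomialOrder ν)
    {I : Ideal (MvPolynomial ν K)} (hI : I.IsHomogeneous (homogeneousSubmodule ν K)) :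
    IsGin σ I (genericInitialIdeal σ I) := by
  obtain ⟨F, hF, h⟩ := holdsGenerically_genericInitialIdeal_le σ I
  refine ⟨F, hF, fun a ha g hg => ?_⟩
  have hle := h a ha
  beta_reduce at hle
  rw [show (Matrix.of fun k l => a (k, l)) = (g : Matrix ν ν K) from
    Matrix.ext fun k l => (hg k l).symm] at hle
  exact le_antisymm (initialIdeal_le_genericInitialIdeal σ hI g hle) hle

/-- Absorbing the determinant into the polynomial removes the invertibility condition on `g`. -/
theorem IsGin.exists_ne_zero [DecidableEq ν] {σ : MonomialOrder ν}
    {I J : Ideal (MvPolynomial ν K)} (h : IsGin σ I J) :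
    ∃ F : MvPolynomial (ν × ν) K, F ≠ 0 ∧ ∀ g : Matrix ν ν K,
      eval (fun p => g p.1 p.2) F ≠ 0 → initialIdeal σ (I.map (linearChange g)) = J := by
  obtain ⟨F, hF, h⟩ := h
  refine ⟨F * (Matrix.mvPolynomialX ν ν K).det,
    mul_ne_zero hF (Matrix.det_mvPolynomialX_ne_zero _ _), fun g hg => ?_⟩
  rw [map_mul, Matrix.eval_det_mvPolynomialX, mul_ne_zero_iff] at hg
  exact h _ hg.1 (Matrix.GeneralLinearGroup.mkOfDetNeZero g hg.2) fun _ _ => rfl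

/-- Over an infinite field two nonempty open sets meet. -/
theorem IsGin.eq [DecidableEq ν] [Infinite K] {σ : MonomialOrder ν}
    {I J J' : Ideal (MvPolynomial ν K)} (h : IsGin σ I J) (h' : IsGin σ I J') : J = J' := by
  obtain ⟨F, hF, h⟩ := h.exists_ne_zero
  obtain ⟨F', hF', h'⟩ := h'.exists_ne_zero
  obtain ⟨a, ha⟩ : ∃ a, eval a (F * F') ≠ 0 := by
    by_contra! hall
    exact mul_ne_zero hF hF' (MvPolynomial.funext fun a => by rw [hall, map_zero])
  rw [map_mul, mul_ne_zero_iff] at ha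
  exact (h (Matrix.of fun k l => a (k, l)) ha.1).symm.trans
    (h' (Matrix.of fun k l => a (k, l)) ha.2)

theorem IsGin.isGin_gin [DecidableEq ν] {σ : MonomialOrder ν} {I J : Ideal (MvPolynomial ν K)}
    (h : IsGin σ I J) : IsGin σ I (gin σ I) := by
  have hex : ∃ J, IsGin σ I J := ⟨J, h⟩
  rw [gin, dif_pos hex]
  exact hex.choose_spec

end Gin

/-! ### Hyperplane sections and DegRev type orderings. -/

section Hyperplane

theorem includeExponents_apply_self {ν : Type*} (i : ν) (s : {j : ν // j ≠ i} →₀ ℕ) : includeExponents i s i = 0 :=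
  Finsupp.mapDomain_of_notMem_range _ _ (by simp)

theorem exists_includeExponents_eq {ν : Type*} (i : ν) {t : ν →₀ ℕ} (ht : t i = 0) :
    ∃ s, includeExponents i s = t := by
  refine ⟨t.comapDomain Subtype.val Subtype.val_injective.injOn,
    Finsupp.mapDomain_comapDomain _ Subtype.val_injective _ fun j hj => ?_⟩
  rw [Subtype.range_coe_subtype]
  rintro rfl
  exact Finsupp.mem_support_iff.1 hj ht

variable {ν K : Type*} [Fintype ν] [DecidableEq ν] [Field K] (i : ν)

theorem hyperplaneHom_single_monomial_includeExponents (s : {j : ν // j ≠ i} →₀ ℕ) (c : K) :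
    hyperplaneHom i (Pi.single i 1) (monomial (includeExponents i s) c) = monomial s c := by
  have : monomial (includeExponents i s) c = rename Subtype.val (monomial s c) := by
    rw [rename_monomial]; rfl
  rw [this, hyperplaneHom, aeval_rename]
  have : (fun j : ν => if hj : j = i then -(C ((Pi.single i 1 : ν → K) i)⁻¹ *
      ∑ k : {k : ν // k ≠ i}, C ((Pi.single i 1 : ν → K) k) * X k)
      else (X ⟨j, hj⟩ : MvPolynomial {j : ν // j ≠ i} K)) ∘ Subtype.val = X := by
    funext j
    simp [j.2]
  rw [this, aeval_X_left_apply]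

theorem hyperplaneHom_single_monomial_of_ne_zero {t : ν →₀ ℕ} (ht : t i ≠ 0) (c : K) :
    hyperplaneHom i (Pi.single i 1) (monomial t c) = 0 := by
  have hsum : ∑ k : {k : ν // k ≠ i}, C ((Pi.single i 1 : ν → K) k) * X k =
      (0 : MvPolynomial {j : ν // j ≠ i} K) :=
    Finset.sum_eq_zero fun k _ => by simp [Pi.single_eq_of_ne k.2]
  rw [hyperplaneHom, aeval_monomial, Finsupp.prod,
    Finset.prod_eq_zero (Finsupp.mem_support_iff.2 ht), mul_zero]
  rw [dif_pos rfl, hsum, mul_zero, neg_zero, zero_pow ht]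

/-- For the form `x_i`, encoded as `Pi.single i 1`, the section just discards the monomials
divisible by `x_i`. -/
theorem coeff_hyperplaneHom_single (s : {j : ν // j ≠ i} →₀ ℕ) (f : MvPolynomial ν K) :
    coeff s (hyperplaneHom i (Pi.single i 1) f) = coeff (includeExponents i s) f := by
  induction f using MvPolynomial.induction_on' with
  | add p q hp hq => rw [map_add, coeff_add, coeff_add, hp, hq]
  | monomial t c =>
    by_cases ht : t i = 0
    · obtain ⟨t, rfl⟩ := exists_includeExponents_eq i ht
      rw [hyperplaneHom_single_monomial_includeExponents, coeff_monomial, coeff_monomial]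
      simp only [(includeExponents_injective i).eq_iff]
    · rw [hyperplaneHom_single_monomial_of_ne_zero i ht, coeff_zero, coeff_monomial, if_neg]
      rintro rfl
      exact ht (includeExponents_apply_self i s)

theorem hyperplaneHom_surjective (h : ν → K) : Function.Surjective (hyperplaneHom i h) := by
  intro p
  refine ⟨rename Subtype.val p, ?_⟩
  rw [hyperplaneHom, aeval_rename]
  have : (fun j : ν => if hj : j = i then -(C (h i)⁻¹ *
      ∑ k : {k : ν // k ≠ i}, C (h k) * X k)
      else (X ⟨j, hj⟩ : MvPolynomial {j : ν // j ≠ i} K)) ∘ Subtype.val = X := by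
    funext j
    simp [j.2]
  rw [this, aeval_X_left_apply]

variable {i} {σ : MonomialOrder ν}

/-- Within one degree, every monomial free of `x_i` beats every monomial divisible by it. So if
anything survives `x_i ↦ 0`, the leading term does. -/
theorem degree_eq_includeExponents_degree (hσ : IsDegRevType i σ) {f : MvPolynomial ν K} {d : ℕ}
    (hf : f.IsHomogeneous d) (h0 : hyperplaneHom i (Pi.single i 1) f ≠ 0) :
    σ.degree f =
      includeExponents i ((restrictOrder i σ).degree (hyperplaneHom i (Pi.single i 1) f)) := by
  have hc := (restrictOrder i σ).coeff_degree_ne_zero_iff.2 h0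
  rw [coeff_hyperplaneHom_single] at hc
  refine σ.degree_eq_of_coeff_ne_zero hc fun u hu => ?_
  by_cases hui : u i = 0
  · obtain ⟨s, rfl⟩ := exists_includeExponents_eq i hui
    rw [← coeff_hyperplaneHom_single] at hu
    exact (restrictOrder_le_iff i σ _ _).1 ((restrictOrder i σ).le_degree (mem_support_iff.2 hu))
  · refine (hσ.rev _ _ ?_ ?_).le
    · have h1 := hf hc
      have h2 := hf hu
      rw [Pi.one_def, ← Finsupp.degree_eq_weight_one] at h1 h2
      exact h1.trans h2.symm
    · rw [includeExponents_apply_self]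
      exact Nat.pos_of_ne_zero hui

theorem initialIdeal_hyperplaneSection_single (hσ : IsDegRevType i σ)
    {I : Ideal (MvPolynomial ν K)} (hI : I.IsHomogeneous (homogeneousSubmodule ν K)) :
    initialIdeal (restrictOrder i σ) (hyperplaneSection i (Pi.single i 1) I) =
      hyperplaneSection i (Pi.single i 1) (initialIdeal σ I) := by
  classical
  apply le_antisymm
  · rw [initialIdeal, Ideal.span_le]
    rintro _ ⟨p, hp, hp0, rfl⟩
    obtain ⟨f, hf, rfl⟩ := (Ideal.mem_map_iff_of_surjective (hyperplaneHom i (Pi.single i 1))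
      (hyperplaneHom_surjective i _)).1 hp
    set s := (restrictOrder i σ).degree (hyperplaneHom i (Pi.single i 1) f) with hs
    -- The DegRev condition is used within a single degree, so `f` is replaced by the component
    -- carrying the leading term of its image.
    set q := homogeneousComponent (includeExponents i s).degree f with hq
    have hc := (restrictOrder i σ).coeff_degree_ne_zero_iff.2 hp0
    have hc' : coeff s (hyperplaneHom i (Pi.single i 1) q) ≠ 0 := by
      rw [coeff_hyperplaneHom_single] at hc ⊢
      rwa [hq, coeff_homogeneousComponent, if_pos rfl]
    have hq0 : hyperplaneHom i (Pi.single i 1) q ≠ 0 := fun h => hc' (by rw [h, coeff_zero])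
    have hdeg : (restrictOrder i σ).degree (hyperplaneHom i (Pi.single i 1) q) = s := by
      refine MonomialOrder.degree_eq_of_coeff_ne_zero _ hc' fun u hu => ?_
      refine (restrictOrder i σ).le_degree (mem_support_iff.2 fun h => hu ?_)
      rw [coeff_hyperplaneHom_single] at h ⊢
      rw [hq, coeff_homogeneousComponent, h, ite_self]
    have hmem : monomial (includeExponents i s) (1 : K) ∈ initialIdeal σ I :=
      (monomial_mem_initialIdeal_iff σ).2 ⟨q, homogeneousComponent_mem_of_isHomogeneous hI hf _,
        fun h => hq0 (by rw [h, map_zero]), by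
        rw [degree_eq_includeExponents_degree hσ (homogeneousComponent_isHomogeneous _ _) hq0,
          hdeg]⟩
    have := Ideal.mem_map_of_mem (hyperplaneHom i (Pi.single i 1)) hmem
    rwa [hyperplaneHom_single_monomial_includeExponents] at this
  · rw [hyperplaneSection, Ideal.map_le_iff_le_comap, initialIdeal, Ideal.span_le]
    rintro _ ⟨f, hf, hf0, rfl⟩
    rw [SetLike.mem_coe, Ideal.mem_comap]
    by_cases ht : σ.degree f i = 0
    · obtain ⟨s, hs⟩ := exists_includeExponents_eq i ht
      obtain ⟨p, hpI, hph, hp0, hpd⟩ := exists_isHomogeneous_degree_eq σ hI hf hf0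
      have hc : coeff s (hyperplaneHom i (Pi.single i 1) p) ≠ 0 := by
        rw [coeff_hyperplaneHom_single, hs, ← hpd]
        exact σ.coeff_degree_ne_zero_iff.2 hp0
      have hq0 : hyperplaneHom i (Pi.single i 1) p ≠ 0 := fun h => hc (by rw [h, coeff_zero])
      rw [← hs, hyperplaneHom_single_monomial_includeExponents]
      refine (monomial_mem_initialIdeal_iff _).2 ⟨_, Ideal.mem_map_of_mem _ hpI, hq0, ?_⟩
      apply includeExponents_injective i
      rw [← degree_eq_includeExponents_degree hσ hph hq0, hpd, hs]
    · rw [hyperplaneHom_single_monomial_of_ne_zero i ht]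
      exact Ideal.zero_mem _

/-- The condition `hg` says that `g` sends the form `h` to a multiple of `x_i`. It expresses column
`i` of `g`, off row `i`, through the other columns, with the same coefficients by which
`hyperplaneHom i h` replaces `x_i`. -/
theorem hyperplaneHom_single_comp_linearChange {g : Matrix ν ν K} {h : ν → K} (hi : h i ≠ 0)
    (hg : ∀ k ≠ i, ∑ j, g k j * h j = 0) :
    (hyperplaneHom i (Pi.single i 1)).comp (linearChange g) =
      (linearChange (g.submatrix Subtype.val Subtype.val)).comp (hyperplaneHom i h) := by
  have hX : ∀ j, hyperplaneHom i (Pi.single i (1 : K)) (linearChange g (X j)) =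
      ∑ k : {k : ν // k ≠ i}, C (g k j) * X k := by
    intro j
    rw [linearChange, aeval_X, map_sum, Fintype.sum_eq_add_sum_subtype_ne _ i, map_mul]
    have hi0 : hyperplaneHom i (Pi.single i (1 : K)) (X i) = 0 :=
      hyperplaneHom_single_monomial_of_ne_zero i (by simp) 1
    rw [hi0, mul_zero, zero_add]
    refine Finset.sum_congr rfl fun k _ => ?_
    rw [map_mul, algHom_C, algebraMap_eq]
    simp [hyperplaneHom, k.2]
  refine algHom_ext fun j => ?_
  rw [AlgHom.comp_apply, AlgHom.comp_apply, hX]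
  by_cases hj : j = i
  · subst hj
    have hcol : ∀ k : {k : ν // k ≠ j}, g k j = -((h j)⁻¹ * ∑ l : {l : ν // l ≠ j}, h l * g k l) := by
      intro k
      have := hg k k.2
      rw [Fintype.sum_eq_add_sum_subtype_ne _ j] at this
      simp only [mul_comm (h _)]
      field_simp
      linear_combination this
    rw [hyperplaneHom, aeval_X, dif_pos rfl]
    simp only [linearChange, map_neg, map_mul, map_sum, algHom_C, algebraMap_eq, aeval_X,
      Matrix.submatrix_apply]
    calc ∑ k : {k : ν // k ≠ j}, C (g k j) * X k
        = ∑ k : {k : ν // k ≠ j},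
            C (-((h j)⁻¹ * ∑ l : {l : ν // l ≠ j}, h l * g k l)) * X k :=
          Finset.sum_congr rfl fun k _ => by rw [← hcol k]
      _ = _ := by
          simp only [map_neg, map_mul, map_sum, Finset.mul_sum, Finset.sum_mul, neg_mul,
            Finset.sum_neg_distrib]
          rw [Finset.sum_comm]
          simp only [mul_assoc]
  · rw [hyperplaneHom, aeval_X, dif_neg hj, linearChange, aeval_X]
    rfl

theorem hyperplaneSection_single_map_linearChange {g : Matrix ν ν K} {h : ν → K} (hi : h i ≠ 0)
    (hg : ∀ k ≠ i, ∑ j, g k j * h j = 0) (I : Ideal (MvPolynomial ν K)) :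
    hyperplaneSection i (Pi.single i 1) (I.map (linearChange g)) =
      (hyperplaneSection i h I).map (linearChange (g.submatrix Subtype.val Subtype.val)) := by
  rw [hyperplaneSection, hyperplaneSection, Ideal.map_mapₐ, Ideal.map_mapₐ,
    hyperplaneHom_single_comp_linearChange hi hg]

end Hyperplane

/-! ### Matrices with prescribed submatrix and prescribed kernel condition. -/

section Extension

variable {ν R S : Type*} [DecidableEq ν] (i : ν)

/-- The matrix with row `i` given by `r`, the rest of column `i` given by `c`, and the remaining
entries given by `B`. -/
def extendMatrix (r : ν → R) (c : {j : ν // j ≠ i} → R)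
    (B : {j : ν // j ≠ i} → {j : ν // j ≠ i} → R) : Matrix ν ν R :=
  Matrix.of fun k j => if hk : k = i then r j else if hj : j = i then c ⟨k, hk⟩
    else B ⟨k, hk⟩ ⟨j, hj⟩

theorem extendMatrix_self_apply (r : ν → R) (c : {j : ν // j ≠ i} → R)
    (B : {j : ν // j ≠ i} → {j : ν // j ≠ i} → R) (j : ν) : extendMatrix i r c B i j = r j :=
  dif_pos rfl

theorem extendMatrix_apply_self (r : ν → R) (c : {j : ν // j ≠ i} → R)
    (B : {j : ν // j ≠ i} → {j : ν // j ≠ i} → R) (k : {j : ν // j ≠ i}) :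
    extendMatrix i r c B k i = c k := by
  simp [extendMatrix, k.2]

theorem extendMatrix_apply_apply (r : ν → R) (c : {j : ν // j ≠ i} → R)
    (B : {j : ν // j ≠ i} → {j : ν // j ≠ i} → R) (k j : {j : ν // j ≠ i}) :
    extendMatrix i r c B k j = B k j := by
  simp [extendMatrix, k.2, j.2]

theorem map_extendMatrix_apply (f : R → S) (r : ν → R) (c : {j : ν // j ≠ i} → R)
    (B : {j : ν // j ≠ i} → {j : ν // j ≠ i} → R) (k j : ν) :
    f (extendMatrix i r c B k j) =
      extendMatrix i (fun j => f (r j)) (fun k => f (c k)) (fun k j => f (B k j)) k j := by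
  simp only [extendMatrix, Matrix.of_apply]
  split_ifs <;> rfl

end Extension

theorem eval_aeval_mvPolynomial {ι κ K : Type*} [Field K] (a : ι → K) (q : κ → MvPolynomial ι K)
    (F : MvPolynomial κ K) : eval a (aeval q F) = eval (fun p => eval a (q p)) F := by
  induction F using MvPolynomial.induction_on with
  | C c => simp
  | add p q hp hq => rw [map_add, map_add, hp, hq, map_add]
  | mul_X p j hp => rw [map_mul, map_mul, hp, map_mul, aeval_X, eval_X]

/-- Generic invertible matrices remain generic when subjected to the condition that all their
rows but the `i`-th are annihilated by a generic vector `h`. -/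
theorem holdsGenerically_exists_extendMatrix {ν K : Type*} [Fintype ν] [DecidableEq ν] [Field K]
    [Infinite K] (i : ν) {F : MvPolynomial (ν × ν) K} (hF : F ≠ 0) :
    HoldsGenerically fun h : ν → K => h i ≠ 0 ∧
      HoldsGenerically fun B : {j : ν // j ≠ i} × {j : ν // j ≠ i} → K =>
        ∃ g : Matrix ν ν K, eval (fun p => g p.1 p.2) F ≠ 0 ∧
          (∀ k ≠ i, ∑ j, g k j * h j = 0) ∧
          ∀ k l, g.submatrix Subtype.val Subtype.val k l = B (k, l) := by
  -- Column `i` of the adjugate is annihilated by all rows but the `i`-th; `D` is its `i`-th entry,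
  -- to be kept nonzero.
  set D := (Matrix.mvPolynomialX ν ν K).adjugate i i with hD
  have hDeval : ∀ g : Matrix ν ν K, eval (fun p : ν × ν => g p.1 p.2) D = g.adjugate i i := by
    intro g
    have h := RingHom.map_adjugate (eval fun p : ν × ν => g p.1 p.2) (Matrix.mvPolynomialX ν ν K)
    rw [Matrix.mvPolynomialX_mapMatrix_eval] at h
    rw [← h]
    rfl
  have hD0 : D ≠ 0 := by
    intro h
    have := hDeval 1
    rw [h, map_zero, Matrix.adjugate_one, Matrix.one_apply_eq] at this
    exact zero_ne_one this
  obtain ⟨a, ha⟩ : ∃ a, eval a (F * D) ≠ 0 := by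
    by_contra! hall
    exact mul_ne_zero hF hD0 (MvPolynomial.funext fun a => by rw [hall, map_zero])
  rw [map_mul, mul_ne_zero_iff] at ha
  set g : Matrix ν ν K := Matrix.of fun k l => a (k, l) with hg
  obtain ⟨hFg, hDg⟩ : eval (fun p => g p.1 p.2) F ≠ 0 ∧ g.adjugate i i ≠ 0 := by
    rw [← hDeval]; exact ha
  set v : ν → K := fun j => g.adjugate j i with hv
  have hgv : ∀ k ≠ i, ∑ j, g k j * v j = 0 := by
    intro k hk
    have := congrFun (congrFun g.mul_adjugate k) i
    rwa [Matrix.mul_apply, Matrix.smul_apply, Matrix.one_apply_ne hk, smul_zero] at this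
  -- Row `i` is frozen at that of `g`. The scaling makes the submatrix `h i • b` and the column
  -- forced by `h` polynomial in `h`, and gives back `g` at `h = v`; hence `H ≠ 0`.
  let b : {j : ν // j ≠ i} → {j : ν // j ≠ i} → K := fun k j => (v i)⁻¹ * g k j
  let H : MvPolynomial ν K := aeval (fun p : ν × ν =>
    extendMatrix i (fun j => C (g i j)) (fun k => -∑ j, C (b k j) * X j.1)
      (fun k j => X i * C (b k j)) p.1 p.2) F
  have hH : ∀ h : ν → K, eval h H = eval (fun p => extendMatrix i (g i)
      (fun k => -∑ j, b k j * h j) (fun k j => h i * b k j) p.1 p.2) F := by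
    intro h
    simp only [H, eval_aeval_mvPolynomial, map_extendMatrix_apply, eval_C, map_neg, map_sum,
      map_mul, eval_X]
  have hHv : eval v H = eval (fun p => g p.1 p.2) F := by
    rw [hH]
    congr 2
    funext p
    obtain ⟨k, j⟩ := p
    simp only
    by_cases hk : k = i
    · subst hk
      rw [extendMatrix_self_apply]
    lift k to {k : ν // k ≠ i} using hk
    by_cases hj : j = i
    · rw [hj, extendMatrix_apply_self]
      have := hgv k k.2
      rw [Fintype.sum_eq_add_sum_subtype_ne _ i] at this
      simp only [b, mul_assoc, ← Finset.mul_sum]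
      rw [← eq_neg_iff_add_eq_zero] at this
      rw [← mul_neg, ← this, mul_comm (g k i), inv_mul_cancel_left₀ hDg]
    · lift j to {j : ν // j ≠ i} using hj
      rw [extendMatrix_apply_apply, mul_inv_cancel_left₀ hDg]
  refine ⟨X i * H, mul_ne_zero (X_ne_zero i) fun h => hFg ?_, fun h hh => ?_⟩
  · rw [← hHv, h, map_zero]
  rw [map_mul, eval_X, mul_ne_zero_iff] at hh
  obtain ⟨hi, hHh⟩ := hh
  -- Now `h` is fixed and the submatrix varies; the rest of column `i` is forced by annihilation of
  -- `h`.
  let E : MvPolynomial ({j : ν // j ≠ i} × {j : ν // j ≠ i}) K := aeval (fun p : ν × ν =>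
    extendMatrix i (fun j => C (g i j)) (fun k => -∑ j, C ((h i)⁻¹ * h j.1) * X (k, j))
      (fun k j => X (k, j)) p.1 p.2) F
  have hE : ∀ B : {j : ν // j ≠ i} × {j : ν // j ≠ i} → K,
      eval B E = eval (fun p => extendMatrix i (g i)
        (fun k => -∑ j, (h i)⁻¹ * h j.1 * B (k, j)) (fun k j => B (k, j)) p.1 p.2) F := by
    intro B
    simp only [E, eval_aeval_mvPolynomial, map_extendMatrix_apply, eval_C, map_neg, map_sum,
      map_mul, eval_X]
  refine ⟨hi, E, fun h0 => hHh ?_, fun B hB => ?_⟩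
  -- At the submatrix `h i • b`, `E` takes the value of `H` at `h`, which is nonzero.
  · have h1 := hE fun p => h i * b p.1 p.2
    rw [h0, map_zero] at h1
    rw [h1, hH]
    have hb : ∀ k j, (h i)⁻¹ * h j.1 * (h i * b k j) = b k j * h j.1 := fun k j => by
      rw [mul_assoc, mul_left_comm (h j.1), inv_mul_cancel_left₀ hi, mul_comm]
    simp only [hb]
  · rw [hE] at hB
    refine ⟨_, hB, fun k hk => ?_, fun k l => ?_⟩
    swap
    · rw [Matrix.submatrix_apply, extendMatrix_apply_apply]
    lift k to {k : ν // k ≠ i} using hk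
    rw [Fintype.sum_eq_add_sum_subtype_ne _ i, extendMatrix_apply_self]
    simp only [extendMatrix_apply_apply]
    rw [neg_mul, neg_add_eq_zero, Finset.sum_mul]
    refine Finset.sum_congr rfl fun j _ => ?_
    field_simp

theorem mainTheorem11 {K : Type*} [Field K] [Infinite K] {n : ℕ} (i : Fin n)
    (σ : MonomialOrder (Fin n)) (hσ : IsDegRevType i σ)
    (I : Ideal (MvPolynomial (Fin n) K))
    (hI : I.IsHomogeneous (homogeneousSubmodule (Fin n) K)) :
    IsGin σ I (gin σ I) ∧
    HoldsGenerically fun h : Fin n → K =>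
      h i ≠ 0 ∧
      IsGin (restrictOrder i σ) (hyperplaneSection i h I)
        (gin (restrictOrder i σ) (hyperplaneSection i h I)) ∧
      gin (restrictOrder i σ) (hyperplaneSection i h I) =
        hyperplaneSection i (Pi.single i 1) (gin σ I) := by
  have hgin : IsGin σ I (gin σ I) := (isGin_genericInitialIdeal σ hI).isGin_gin
  refine ⟨hgin, ?_⟩
  obtain ⟨F, hF, hFg⟩ := hgin.exists_ne_zero
  obtain ⟨H, hH0, hH⟩ := holdsGenerically_exists_extendMatrix i hF
  refine ⟨H, hH0, fun h hh => ?_⟩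
  obtain ⟨hi, E, hE0, hE⟩ := hH h hh
  have key : IsGin (restrictOrder i σ) (hyperplaneSection i h I)
      (hyperplaneSection i (Pi.single i 1) (gin σ I)) := by
    refine ⟨E, hE0, fun B hB g' hg' => ?_⟩
    obtain ⟨g, hgF, hgh, hgB⟩ := hE B hB
    have hsub : (g' : Matrix {j // j ≠ i} {j // j ≠ i} K) =
        g.submatrix Subtype.val Subtype.val :=
      Matrix.ext fun k l => (hg' k l).trans (hgB k l).symm
    rw [hsub, ← hyperplaneSection_single_map_linearChange hi hgh,
      initialIdeal_hyperplaneSection_single hσ (map_linearChange_isHomogeneous g hI), hFg g hgF]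
  exact ⟨hi, key.isGin_gin, key.isGin_gin.eq key⟩
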